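/- Let $2^\omega$ be the Cantor space and let $\mathcal{H}(2^\omega)$ be its group of self-homeomorphisms under composition. For a subgroup $\mathcal{S}$ of $\mathcal{H}(2^\omega)$ and $X\subseteq 2^\omega$ write $\mathcal{S}[X]=\bigcup_{h\in\mathcal{S}}h[X]$, and write $\langle\mathcal{T}\rangle$ for the subgroup of $\mathcal{H}(2^\omega)$ generated by $\mathcal{T}\subseteq\mathcal{H}(2^\omega)$. Assume Martin's Axiom for $\sigma$-centered posets, that is: for every non-empty poset $P$ that is a countable union of centered sets (a set $C\subseteq P$ is centered if every finite subset of $C$ has a lower bound in $P$) and every family of fewer than $\mathfrak{c}$ dense subsets of $P$, there is a filter on $P$ that meets every member of the family. Assume furthermore that: - $X$ and $Y$ are subsets of $2^\omega$ of size less than $\mathfrak{c}$; - $\mathcal{H}$ is a subgroup of $\mathcal{H}(2^\omega)$ of size less than $\mathfrak{c}$; - $\mathcal{H}[X]\cap Y=\varnothing$; - $D$ is a countable dense subset of $2^\omega$ such that $D\subseteq Y$; - $h[D]\cap D=\varnothing$ for every $h\in\mathcal{H}\setminus\{\mathrm{id}\}$; - $A$ and $B$ are countable dense subsets of $2^\omega$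 such that $A\cup B\subseteq X$. Then there exists $f\in\mathcal{H}(2^\omega)$ such that: 1. $f[A]=B$; 2. $\langle\mathcal{H}\cup\{f\}\rangle[X]\cap Y=\varnothing$; 3. $h[D]\cap D=\varnothing$ for every $h\in\langle\mathcal{H}\cup\{f\}\rangle\setminus\{\mathrm{id}\}$. -/

import Mathlib

open Cardinal

/-- A subset `C` of a forcing poset `P` is centered if every finite subset of `C` has a
lower bound (a common extension) in `P`. -/
def Forcing.IsCentered {P : Type*} [Preorder P] (C : Set P) : Prop :=
  ∀ F : Finset P, (F : Set P) ⊆ C → ∃ q : P, ∀ p ∈ F, q ≤ p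

/-- A forcing poset is σ-centered if it is the union of countably many centered subsets. -/
def Forcing.IsSigmaCentered (P : Type*) [Preorder P] : Prop :=
  ∃ C : ℕ → Set P, (∀ n, Forcing.IsCentered (C n)) ∧ (⋃ n, C n) = Set.univ

/-- Martin's Axiom for σ-centered posets: for every nonempty σ-centered forcing poset `P`
(a preorder, as usual in forcing) and every family of fewer than `𝔠` dense subsets of `P`
(`E` is dense if every condition has an extension in `E`, that is, `IsCoinitial E`) there is a filter on `P` meeting every member of the family. -/
def MASigmaCentered : Prop :=
  ∀ (P : Type) [Preorder P] [Nonempty P], Forcing.IsSigmaCentered P →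
    ∀ 𝓔 : Set (Set P), #𝓔 < 𝔠 → (∀ E ∈ 𝓔, IsCoinitial E) →
      ∃ G : Order.PFilter P, ∀ E ∈ 𝓔, ∃ p ∈ E, p ∈ G

/-- The Cantor space `2^ω`, with the product topology of the discrete space `Bool`. -/
abbrev Cantor : Type := ℕ → Bool

/-- `groupImage H X` is `H[X] = ⋃_{h ∈ H} h[X]`, the closure of `X` under the action of a group `H`
of self-homeomorphisms (the group operation on `Z ≃ₜ Z` is composition). -/
def groupImage {Z : Type*} [TopologicalSpace Z] (H : Subgroup (Z ≃ₜ Z)) (X : Set Z) : Set Z :=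
  ⋃ h ∈ H, h '' X

/-! The map `f` is sought among the isometries of the standard ultrametric, generic for finite
partial isometries from `A` to `B`; this poset is countable, hence σ-centered. Every element of the
group generated by `H` and `f` is `w(f) h` with `w` reduced and `h ∈ H`. For empty `w` the
hypotheses apply, so it suffices that no nonempty `w` sends a point of `H[X] ∪ H[Y]` into `Y`: fewer
than `𝔠` requirements, met by `exists_generic_isometry`. Each requirement is dense. `exists_trace`
extends a condition to a finite partial isometry, perhaps outside `A × B`, that computes `w` at the
given point, with a value in `H[X]` or outside `H[X] ∪ H[Y]`, hence not the forbidden one. Since the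
value of a word varies continuously with the isometry, `exists_approx` moves the pairs back into `A
× B` without spoiling this (`exists_cond_evalWord_ne`). -/

namespace CantorIsometry

/-! ### Initial segments and cylinders. -/

/-- `Agree n x y` says that `x` and `y` have the same first `n` coordinates. -/
def Agree (n : ℕ) (x y : Cantor) : Prop := ∀ i < n, x i = y i

namespace Agree

theorem refl (n : ℕ) (x : Cantor) : Agree n x x := fun _ _ => rfl

theorem symm {n : ℕ} {x y : Cantor} (h : Agree n x y) : Agree n y x := fun i hi => (h i hi).symm

theorem trans {n : ℕ} {x y z : Cantor} (h : Agree n x y) (h' : Agree n y z) : Agree n x z :=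
  fun i hi => (h i hi).trans (h' i hi)

theorem mono {m n : ℕ} {x y : Cantor} (h : Agree n x y) (hmn : m ≤ n) : Agree m x y :=
  fun i hi => h i (hi.trans_le hmn)

theorem eq_of_forall {x y : Cantor} (h : ∀ n, Agree n x y) : x = y :=
  funext fun i => h (i + 1) i i.lt_succ_self

theorem iff_le {m n : ℕ} {x y : Cantor} (h : Agree m x y) (hne : x m ≠ y m) :
    Agree n x y ↔ n ≤ m :=
  ⟨fun h' => not_lt.1 fun hlt => hne (h' m hlt), fun hle => h.mono hle⟩

end Agree

theorem setOf_agree_eq_cylinder (x : Cantor) (n : ℕ) :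
    {y | Agree n x y} = PiNat.cylinder (E := fun _ => Bool) x n := by
  ext y
  exact ⟨fun h i hi => (h i hi).symm, fun h i hi => (h i hi).symm⟩

theorem isOpen_setOf_agree (x : Cantor) (n : ℕ) : IsOpen {y | Agree n x y} := by
  rw [setOf_agree_eq_cylinder]
  exact PiNat.isOpen_cylinder _ x n

theorem exists_agree_subset {O : Set Cantor} (hO : IsOpen O) {x : Cantor} (hx : x ∈ O) :
    ∃ n, ∀ y, Agree n x y → y ∈ O := by
  obtain ⟨v, ⟨y, n, rfl⟩, hxv, hvO⟩ :=
    (PiNat.isTopologicalBasis_cylinders (fun _ => Bool)).exists_subset_of_mem_open hx hO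
  refine ⟨n, fun z hz => hvO fun i hi => ?_⟩
  rw [← hz i hi]
  exact hxv i hi

theorem exists_mem_agree {A : Set Cantor} (hA : Dense A) (x : Cantor) (n : ℕ) :
    ∃ a ∈ A, Agree n x a := by
  obtain ⟨a, ha, haA⟩ := hA.inter_open_nonempty _ (isOpen_setOf_agree x n) ⟨x, Agree.refl n x⟩
  exact ⟨a, haA, ha⟩

theorem continuous_of_agree {f : Cantor → Cantor}
    (hf : ∀ n x y, Agree n x y → Agree n (f x) (f y)) : Continuous f := by
  rw [continuous_def]
  intro O hO
  rw [isOpen_iff_mem_nhds]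
  intro x hx
  obtain ⟨n, hn⟩ := exists_agree_subset hO hx
  exact Filter.mem_of_superset ((isOpen_setOf_agree x n).mem_nhds (Agree.refl n x))
    fun y hy => hn _ (hf n x y hy)

/-- Every cylinder has a point outside a given set of size less than the continuum. -/
theorem exists_agree_notMem {S : Set Cantor} (hS : #S < 𝔠) (x : Cantor) (n : ℕ) :
    ∃ z, Agree n x z ∧ z ∉ S := by
  by_contra! hcon
  let g : Cantor → S := fun y =>
    ⟨fun i => if i < n then x i else y (i - n), hcon _ fun i hi => by simp [hi]⟩
  have hg : Function.Injective g := by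
    intro y y' hyy
    funext i
    have := congrFun (congrArg Subtype.val hyy) (i + n)
    simpa [g] using this
  have h1 := Cardinal.mk_le_of_injective hg
  have h2 : #Cantor = 𝔠 := by simp [Cantor]
  exact absurd hS (not_lt.2 (h2 ▸ h1))

/-! ### Finite partial isometries: extension, approximation, completion. -/

/-- A relation that preserves the standard ultrametric of the Cantor space. -/
def PartialIso (R : Set (Cantor × Cantor)) : Prop :=
  ∀ p ∈ R, ∀ q ∈ R, ∀ n, Agree n p.1 q.1 ↔ Agree n p.2 q.2

/-- The pair `(u, z)`, read backwards if `e` is `false`. -/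
def orient (e : Bool) (u z : Cantor) : Cantor × Cantor := if e then (u, z) else (z, u)

namespace PartialIso

theorem mono {R S : Set (Cantor × Cantor)} (hS : PartialIso S) (h : R ⊆ S) : PartialIso R :=
  fun p hp q hq => hS p (h hp) q (h hq)

theorem swap {R : Set (Cantor × Cantor)} (hR : PartialIso R) : PartialIso (Prod.swap ⁻¹' R) :=
  fun p hp q hq n => (hR p.swap hp q.swap hq n).symm

theorem insert {R : Set (Cantor × Cantor)} (hR : PartialIso R) {u z : Cantor}
    (h : ∀ p ∈ R, ∀ n, Agree n u p.1 ↔ Agree n z p.2) : PartialIso (insert (u, z) R) := by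
  rintro p (rfl | hp) q (rfl | hq) n
  · exact ⟨fun _ => Agree.refl _ _, fun _ => Agree.refl _ _⟩
  · exact h q hq n
  · exact ⟨fun hn => ((h p hp n).1 hn.symm).symm, fun hn => ((h p hp n).2 hn.symm).symm⟩
  · exact hR p hp q hq n

/-- The admissible values of a finite partial isometry at a new point contain a cylinder. -/
theorem exists_agree_insert {R : Set (Cantor × Cantor)} (hR : PartialIso R) (hfin : R.Finite)
    {u : Cantor} (hu : ∀ p ∈ R, u ≠ p.1) :
    ∃ z m, ∀ z', Agree m z z' → PartialIso (Insert.insert (u, z') R) := by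
  rcases R.eq_empty_or_nonempty with rfl | hne
  · exact ⟨u, 0, fun z' _ => hR.insert (by simp)⟩
  have hdiff : ∀ p ∈ R, ∃ m, Agree m u p.1 ∧ u m ≠ p.1 m := fun p hp =>
    ⟨PiNat.firstDiff u p.1, fun i hi => PiNat.apply_eq_of_lt_firstDiff hi,
      PiNat.apply_firstDiff_ne (hu p hp)⟩
  choose! d hd hd' using hdiff
  obtain ⟨p, hp, hmax⟩ := Set.exists_max_image R d hfin hne
  -- Here `p.1` is a domain point closest to `u`. The new value must leave `p.2` exactly at
  -- coordinate `d p`; the distances to all other points then follow from those to `p`.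
  refine ⟨Function.update p.2 (d p) (!p.2 (d p)), d p + 1, fun z' hz' => hR.insert ?_⟩
  have hz : Agree (d p) z' p.2 := fun i hi => by
    rw [← hz' i (by omega), Function.update_of_ne hi.ne]
  have hzne : z' (d p) = !p.2 (d p) := by
    rw [← hz' (d p) (by omega), Function.update_self]
  intro q hq n
  rw [(hd q hq).iff_le (hd' q hq)]
  rcases (hmax q hq).lt_or_eq with hlt | heq
  · have hag : Agree (d q) p.1 q.1 := ((hd p hp).mono hlt.le).symm.trans (hd q hq)
    have hnag : ¬ Agree (d q + 1) p.2 q.2 := by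
      rw [← hR p hp q hq]
      intro h
      exact hd' q hq ((hd p hp _ hlt).trans (h _ (Nat.lt_succ_self _)))
    have hag' := (hR p hp q hq _).1 hag
    refine (((hz.mono hlt.le).trans hag').iff_le fun h => hnag fun i hi => ?_).symm
    rcases Nat.lt_succ_iff_lt_or_eq.1 hi with hi | rfl
    · exact hag' i hi
    · rw [← h, hz _ hlt]
  -- With only two letters, `p.1` and `q.1` both differ from `u` at `d q`, so they agree there.
  · have hag : Agree (d q + 1) p.1 q.1 := fun i hi => by
      rcases Nat.lt_succ_iff_lt_or_eq.1 hi with hi | rfl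
      · rw [← hd p hp i (heq ▸ hi), hd q hq i hi]
      · have h1 := hd' q hq
        have h2 := hd' p hp
        rw [← heq] at h2
        revert h1 h2
        cases u (d q) <;> cases p.1 (d q) <;> cases q.1 (d q) <;> simp
    have hag' := (hR p hp q hq _).1 hag
    rw [← heq] at hz hzne
    refine ((hz.trans (hag'.mono (Nat.le_succ _))).iff_le ?_).symm
    rw [hzne, ← hag' _ (Nat.lt_succ_self _)]
    cases p.2 (d q) <;> simp

theorem exists_agree_insert_orient {R : Set (Cantor × Cantor)} (hR : PartialIso R)
    (hfin : R.Finite) {e : Bool} {u : Cantor} (hu : ∀ v, orient e u v ∉ R) :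
    ∃ z m, ∀ z', Agree m z z' → PartialIso (Insert.insert (orient e u z') R) := by
  cases e
  · obtain ⟨z, m, h⟩ := hR.swap.exists_agree_insert (u := u)
      (hfin.preimage Prod.swap_injective.injOn) (by
        rintro ⟨a, b⟩ hp rfl
        exact hu b hp)
    refine ⟨z, m, fun z' hz' => (h z' hz').swap.mono ?_⟩
    rintro p (rfl | hp)
    · exact Or.inl rfl
    · exact Or.inr hp
  · refine hR.exists_agree_insert hfin ?_
    rintro ⟨a, b⟩ hp rfl
    exact hu b hp

/-- A finite partial isometry is approximated, as closely as desired, by one between two given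
dense sets, without changing the pairs that it already has between these sets. -/
theorem exists_approx {A B : Set Cantor} (hA : Dense A) (hB : Dense B)
    {R : Set (Cantor × Cantor)} (hR : PartialIso R) (hfin : R.Finite) (N : ℕ) :
    ∃ S : Set (Cantor × Cantor), S.Finite ∧ S ⊆ A ×ˢ B ∧ PartialIso S ∧ R ∩ A ×ˢ B ⊆ S ∧
      ∀ p ∈ R, ∃ q ∈ S, Agree N p.1 q.1 ∧ Agree N p.2 q.2 := by
  -- Beyond a level `M` separating the finitely many pairs, perturbations change no mutual distance.
  have hsep : ∃ M, N ≤ M ∧ ∀ p ∈ R, ∀ q ∈ R, Agree M p.1 q.1 → p = q := by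
    have hev : ∀ᶠ M in Filter.atTop, ∀ p ∈ R, ∀ q ∈ R, Agree M p.1 q.1 → p = q := by
      rw [Filter.eventually_all_finite hfin]
      intro p hp
      rw [Filter.eventually_all_finite hfin]
      intro q hq
      by_cases hpq : p.1 = q.1
      · refine Filter.Eventually.of_forall fun M _ => Prod.ext hpq ?_
        exact Agree.eq_of_forall fun n => (hR p hp q hq n).1 (hpq ▸ Agree.refl n _)
      · filter_upwards [Filter.eventually_gt_atTop (PiNat.firstDiff p.1 q.1)] with M hM h
        exact absurd (h _ hM) (PiNat.apply_firstDiff_ne hpq)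
    exact ((Filter.eventually_ge_atTop N).and hev).exists
  obtain ⟨M, hNM, hM⟩ := hsep
  have hφ : ∀ p : Cantor × Cantor, ∃ q ∈ A ×ˢ B, Agree M p.1 q.1 ∧ Agree M p.2 q.2 ∧
      (p ∈ A ×ˢ B → q = p) := by
    intro p
    by_cases hp : p ∈ A ×ˢ B
    · exact ⟨p, hp, Agree.refl _ _, Agree.refl _ _, fun _ => rfl⟩
    · obtain ⟨a, ha, ha'⟩ := exists_mem_agree hA p.1 M
      obtain ⟨b, hb, hb'⟩ := exists_mem_agree hB p.2 M
      exact ⟨(a, b), ⟨ha, hb⟩, ha', hb', fun h => absurd h hp⟩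
  choose φ hφ h1 h2 hφ' using hφ
  have key : ∀ {x y x' y' : Cantor} {n : ℕ}, Agree M x x' → Agree M y y' → ¬ Agree M x y →
      (Agree n x y ↔ Agree n x' y') := by
    intro x y x' y' n hx hy hxy
    have hxy' : ¬ Agree M x' y' := fun h => hxy ((hx.trans h).trans hy.symm)
    rcases le_total n M with hn | hn
    · exact ⟨fun h => ((hx.mono hn).symm.trans h).trans (hy.mono hn),
        fun h => ((hx.mono hn).trans h).trans (hy.mono hn).symm⟩
    · exact ⟨fun h => absurd (h.mono hn) hxy, fun h => absurd (h.mono hn) hxy'⟩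
  refine ⟨φ '' R, hfin.image φ, Set.image_subset_iff.2 fun p _ => hφ p, ?_,
    fun p hp => ⟨p, hp.1, hφ' p hp.2⟩,
    fun p hp => ⟨φ p, ⟨p, hp, rfl⟩, (h1 p).mono hNM, (h2 p).mono hNM⟩⟩
  rintro _ ⟨p, hp, rfl⟩ _ ⟨q, hq, rfl⟩ n
  by_cases hpq : p = q
  · subst hpq
    exact ⟨fun _ => Agree.refl _ _, fun _ => Agree.refl _ _⟩
  · have hn1 : ¬ Agree M p.1 q.1 := fun h => hpq (hM p hp q hq h)
    have hn2 : ¬ Agree M p.2 q.2 := by rwa [← hR p hp q hq]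
    rw [← key (h1 p) (h1 q) hn1, ← key (h2 p) (h2 q) hn2]
    exact hR p hp q hq n

theorem exists_limit {R : Set (Cantor × Cantor)} (hR : PartialIso R)
    (hdom : ∀ x n, ∃ p ∈ R, Agree n x p.1) (x : Cantor) :
    ∃ z, ∀ p ∈ R, ∀ n, Agree n x p.1 → Agree n z p.2 := by
  choose a haR ha using hdom x
  -- Agreement up to `i + 1` is what fixes coordinate `i`, whichever approximating pair is used.
  refine ⟨fun i => (a (i + 1)).2 i, fun p hp n hn i hi => ?_⟩
  have := ((ha (i + 1)).symm.trans (hn.mono hi))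
  exact (hR _ (haR _) p hp _).1 this i (Nat.lt_succ_self i)

/-- A partial isometry with dense domain and dense range extends to an isometric
self-homeomorphism of the Cantor space. -/
theorem exists_homeomorph {R : Set (Cantor × Cantor)} (hR : PartialIso R)
    (hdom : ∀ x n, ∃ p ∈ R, Agree n x p.1) (hran : ∀ x n, ∃ p ∈ R, Agree n x p.2) :
    ∃ f : Cantor ≃ₜ Cantor, (∀ n x y, Agree n x y ↔ Agree n (f x) (f y)) ∧
      ∀ p ∈ R, f p.1 = p.2 := by
  choose f hf using hR.exists_limit hdom
  choose g hg using hR.swap.exists_limit fun x n => by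
    obtain ⟨p, hp, h⟩ := hran x n
    exact ⟨p.swap, hp, h⟩
  replace hg : ∀ x, ∀ p ∈ R, ∀ n, Agree n x p.2 → Agree n (g x) p.1 :=
    fun x p hp => hg x p.swap hp
  have hfi : ∀ n x y, Agree n x y → Agree n (f x) (f y) := by
    intro n x y h
    obtain ⟨p, hp, hxp⟩ := hdom x n
    exact (hf x p hp n hxp).trans (hf y p hp n (h.symm.trans hxp)).symm
  have hgi : ∀ n x y, Agree n x y → Agree n (g x) (g y) := by
    intro n x y h
    obtain ⟨p, hp, hxp⟩ := hran x n
    exact (hg x p hp n hxp).trans (hg y p hp n (h.symm.trans hxp)).symm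
  have hgf : ∀ x, g (f x) = x := fun x => Agree.eq_of_forall fun n => by
    obtain ⟨p, hp, hxp⟩ := hdom x n
    exact (hg _ p hp n (hf x p hp n hxp)).trans hxp.symm
  have hfg : ∀ x, f (g x) = x := fun x => Agree.eq_of_forall fun n => by
    obtain ⟨p, hp, hxp⟩ := hran x n
    exact (hf _ p hp n (hg x p hp n hxp)).trans hxp.symm
  refine ⟨⟨⟨f, g, hgf, hfg⟩, continuous_of_agree hfi, continuous_of_agree hgi⟩,
    fun n x y => ⟨hfi n x y, fun h => ?_⟩,
    fun p hp => Agree.eq_of_forall fun n => hf _ p hp n (Agree.refl _ _)⟩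
  have := hgi n _ _ h
  change Agree n (g (f x)) (g (f y)) at this
  rwa [hgf, hgf] at this

end PartialIso

/-! ### The forcing poset and its generic isometry. -/

/-- A homeomorphism that preserves the standard ultrametric of the Cantor space. -/
def IsIso (f : Cantor ≃ₜ Cantor) : Prop := ∀ n x y, Agree n x y ↔ Agree n (f x) (f y)

/-- The forcing conditions for an isometry that maps `A` onto `B`: finite partial isometries. -/
def IsCond (A B : Set Cantor) (S : Set (Cantor × Cantor)) : Prop :=
  (S.Finite ∧ S ⊆ A ×ˢ B) ∧ PartialIso S

/-- The poset of conditions, ordered by reverse inclusion. -/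
def Cond (A B : Set Cantor) : Type := {S // IsCond A B S}

instance (A B : Set Cantor) : Preorder (Cond A B) where
  le p q := q.1 ⊆ p.1
  le_refl _ := subset_rfl
  le_trans _ _ _ h h' := h'.trans h

instance (A B : Set Cantor) : Nonempty (Cond A B) :=
  ⟨⟨∅, ⟨Set.finite_empty, Set.empty_subset _⟩, fun _ h => h.elim⟩⟩

theorem countable_cond {A B : Set Cantor} (hA : A.Countable) (hB : B.Countable) :
    Countable (Cond A B) :=
  Set.countable_coe_iff.2 ((Set.countable_ofPred_finite_subset (hA.prod hB)).mono fun _ h => h.1)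

theorem isSigmaCentered_of_countable (P : Type) [Preorder P] [Nonempty P] [Countable P] :
    Forcing.IsSigmaCentered P := by
  obtain ⟨g, hg⟩ := exists_surjective_nat P
  refine ⟨fun n => {g n}, fun n F hF => ⟨g n, fun p hp => ?_⟩, ?_⟩
  · rw [hF hp]
  · ext p
    simpa [eq_comm] using hg p

/-- Density of the requirement that `a` enter the domain: the admissible values contain a cylinder,
which meets `B`. -/
theorem IsCond.exists_mem_dom {A B : Set Cantor} (hB : Dense B) {S : Set (Cantor × Cantor)}
    (hS : IsCond A B S) {a : Cantor} (ha : a ∈ A) :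
    ∃ T, IsCond A B T ∧ S ⊆ T ∧ ∃ b, (a, b) ∈ T := by
  by_cases h : ∃ b, (a, b) ∈ S
  · exact ⟨S, hS, subset_rfl, h⟩
  · push Not at h
    obtain ⟨z, m, hz⟩ := hS.2.exists_agree_insert_orient hS.1.1 (e := true) h
    obtain ⟨b, hb, hzb⟩ := exists_mem_agree hB z m
    exact ⟨_, ⟨⟨hS.1.1.insert _, Set.insert_subset ⟨ha, hb⟩ hS.1.2⟩, hz b hzb⟩,
      Set.subset_insert _ _, b, Or.inl rfl⟩

theorem IsCond.exists_mem_ran {A B : Set Cantor} (hA : Dense A) {S : Set (Cantor × Cantor)}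
    (hS : IsCond A B S) {b : Cantor} (hb : b ∈ B) :
    ∃ T, IsCond A B T ∧ S ⊆ T ∧ ∃ a, (a, b) ∈ T := by
  by_cases h : ∃ a, (a, b) ∈ S
  · exact ⟨S, hS, subset_rfl, h⟩
  · push Not at h
    obtain ⟨z, m, hz⟩ := hS.2.exists_agree_insert_orient hS.1.1 (e := false) h
    obtain ⟨a, ha, hza⟩ := exists_mem_agree hA z m
    exact ⟨_, ⟨⟨hS.1.1.insert _, Set.insert_subset ⟨ha, hb⟩ hS.1.2⟩, hz a hza⟩,
      Set.subset_insert _ _, a, Or.inl rfl⟩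

/-- Under Martin's Axiom there is an isometry that maps `A` onto `B` and has any fewer than `𝔠`
given properties, each of which can be forced below every finite partial isometry. -/
theorem exists_generic_isometry (hMA : MASigmaCentered) {A B : Set Cantor}
    (hAc : A.Countable) (hAd : Dense A) (hBc : B.Countable) (hBd : Dense B)
    {ι : Type} (hι : #ι < 𝔠) (Φ : ι → (Cantor ≃ₜ Cantor) → Prop)
    (hΦ : ∀ i S, IsCond A B S → ∃ T, IsCond A B T ∧ S ⊆ T ∧
      ∀ f, IsIso f → (∀ p ∈ T, f p.1 = p.2) → Φ i f) :
    ∃ f, IsIso f ∧ f '' A = B ∧ ∀ i, Φ i f := by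
  have := countable_cond hAc hBc
  have := hAc.to_subtype
  have := hBc.to_subtype
  let E : ι ⊕ (A ⊕ B) → Set (Cond A B) := Sum.elim
    (fun i => {T | ∀ f, IsIso f → (∀ p ∈ T.1, f p.1 = p.2) → Φ i f})
    (Sum.elim (fun a => {T | ∃ b, (a.1, b) ∈ T.1}) (fun b => {T | ∃ a, (a, b.1) ∈ T.1}))
  have hcard : #(Set.range E) < 𝔠 := by
    refine Cardinal.mk_range_le.trans_lt ?_
    rw [Cardinal.mk_sum, Cardinal.lift_id, Cardinal.lift_id]
    refine Cardinal.add_lt_of_lt Cardinal.aleph0_le_continuum hι ?_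
    exact (Cardinal.mk_le_aleph0 (α := A ⊕ B)).trans_lt Cardinal.aleph0_lt_continuum
  obtain ⟨G, hG⟩ := hMA (Cond A B) (isSigmaCentered_of_countable _) (Set.range E) hcard (by
    rintro _ ⟨i, rfl⟩ S
    rcases i with i | a | b
    · obtain ⟨T, hT, hST, h⟩ := hΦ i S.1 S.2
      exact ⟨⟨T, hT⟩, h, hST⟩
    · obtain ⟨T, hT, hST, h⟩ := S.2.exists_mem_dom hBd a.2
      exact ⟨⟨T, hT⟩, h, hST⟩
    · obtain ⟨T, hT, hST, h⟩ := S.2.exists_mem_ran hAd b.2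
      exact ⟨⟨T, hT⟩, h, hST⟩)
  let R : Set (Cantor × Cantor) := {p | ∃ S ∈ G, p ∈ S.1}
  have hRAB : R ⊆ A ×ˢ B := fun p ⟨S, _, hp⟩ => S.2.1.2 hp
  have hR : PartialIso R := by
    rintro p ⟨S, hS, hp⟩ q ⟨T, hT, hq⟩
    obtain ⟨U, _, hUS, hUT⟩ := G.directed S hS T hT
    exact U.2.2 p (hUS hp) q (hUT hq)
  have hdom : ∀ a ∈ A, ∃ b, (a, b) ∈ R := fun a ha => by
    obtain ⟨S, ⟨b, hb⟩, hS⟩ := hG _ ⟨Sum.inr (Sum.inl ⟨a, ha⟩), rfl⟩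
    exact ⟨b, S, hS, hb⟩
  have hran : ∀ b ∈ B, ∃ a, (a, b) ∈ R := fun b hb => by
    obtain ⟨S, ⟨a, ha⟩, hS⟩ := hG _ ⟨Sum.inr (Sum.inr ⟨b, hb⟩), rfl⟩
    exact ⟨a, S, hS, ha⟩
  obtain ⟨f, hf, hfR⟩ := hR.exists_homeomorph
    (fun x n => by
      obtain ⟨a, ha, h⟩ := exists_mem_agree hAd x n
      obtain ⟨b, hb⟩ := hdom a ha
      exact ⟨_, hb, h⟩)
    (fun x n => by
      obtain ⟨b, hb, h⟩ := exists_mem_agree hBd x n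
      obtain ⟨a, ha⟩ := hran b hb
      exact ⟨_, ha, h⟩)
  refine ⟨f, hf, Set.Subset.antisymm ?_ ?_, fun i => ?_⟩
  · rintro _ ⟨a, ha, rfl⟩
    obtain ⟨b, hb⟩ := hdom a ha
    rw [hfR _ hb]
    exact (hRAB hb).2
  · intro b hb
    obtain ⟨a, ha⟩ := hran b hb
    exact ⟨a, (hRAB ha).1, hfR _ ha⟩
  · obtain ⟨S, hi, hS⟩ := hG _ ⟨Sum.inl i, rfl⟩
    exact hi f hf fun p hp => hfR p ⟨S, hS, hp⟩

/-! ### Reduced words over `H` and `f`. -/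

section Words

variable {H : Subgroup (Cantor ≃ₜ Cantor)}

/-- The homeomorphism `f` or its inverse. -/
def signed (f : Cantor ≃ₜ Cantor) (e : Bool) : Cantor ≃ₜ Cantor := if e then f else f⁻¹

/-- The value at `f` of the word `(e₁, h₁), (e₂, h₂), …`, that is `h₁ f^{e₁} h₂ f^{e₂} ⋯`. -/
def evalWord (f : Cantor ≃ₜ Cantor) : List (Bool × H) → (Cantor ≃ₜ Cantor)
  | [] => 1
  | (e, h) :: w => h * signed f e * evalWord f w

/-- A word is reduced if it nowhere contains `f 1 f⁻¹` or `f⁻¹ 1 f`. -/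
def IsReduced (w : List (Bool × H)) : Prop := w.IsChain fun p q => q.2 = 1 → p.1 = q.1

/-- Only a leading letter `(!e, 1)` can cancel; otherwise prepending `(e, 1)` keeps the word
reduced. The trailing `h₀` is needed because a letter carries its element of `H` on the left. -/
theorem exists_reduced_signed_mul (f : Cantor ≃ₜ Cantor) (e : Bool) {w : List (Bool × H)}
    (hw : IsReduced w) (h₀ : H) :
    ∃ (w' : List (Bool × H)) (h' : H), IsReduced w' ∧
      signed f e * (evalWord f w * h₀) = evalWord f w' * h' := by
  by_cases hc : ∃ w', w = (!e, 1) :: w'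
  · obtain ⟨w', rfl⟩ := hc
    refine ⟨w', h₀, (List.isChain_cons.1 hw).2, ?_⟩
    cases e <;> simp [evalWord, signed, mul_assoc]
  · refine ⟨(e, 1) :: w, h₀, List.isChain_cons.2 ⟨?_, hw⟩, by simp [evalWord, mul_assoc]⟩
    rintro ⟨e', h⟩ hp (rfl : h = 1)
    by_contra hne
    obtain ⟨w', rfl⟩ := List.head?_eq_some_iff.1 hp
    exact hc ⟨w', by cases e <;> cases e' <;> simp_all⟩

theorem exists_reduced_mul_left (f : Cantor ≃ₜ Cantor) (h : H) {w : List (Bool × H)}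
    (hw : IsReduced w) (h₀ : H) :
    ∃ (w' : List (Bool × H)) (h' : H), IsReduced w' ∧
      h * (evalWord f w * h₀) = evalWord f w' * h' := by
  rcases w with _ | ⟨⟨e, k⟩, w⟩
  · exact ⟨[], h * h₀, hw, by simp [evalWord]⟩
  · exact ⟨(e, h * k) :: w, h₀, List.isChain_cons.2 (List.isChain_cons.1 hw),
      by simp [evalWord, mul_assoc]⟩

theorem exists_reduced_of_mem_closure {f g : Cantor ≃ₜ Cantor}
    (hg : g ∈ Subgroup.closure ((H : Set (Cantor ≃ₜ Cantor)) ∪ {f})) :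
    ∃ (w : List (Bool × H)) (h : H), IsReduced w ∧ g = evalWord f w * h := by
  induction hg using Subgroup.closure_induction_left with
  | one => exact ⟨[], 1, List.isChain_nil, by simp [evalWord]⟩
  | mul_left x hx y _ ih =>
    obtain ⟨w, h, hw, rfl⟩ := ih
    rcases hx with hx | rfl
    · exact exists_reduced_mul_left f ⟨x, hx⟩ hw h
    · exact exists_reduced_signed_mul x true hw h
  | inv_mul_cancel x hx y _ ih =>
    obtain ⟨w, h, hw, rfl⟩ := ih
    rcases hx with hx | rfl
    · exact exists_reduced_mul_left f ⟨x⁻¹, H.inv_mem hx⟩ hw h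
    · exact exists_reduced_signed_mul x false hw h

/-! ### Computing words along partial isometries. -/

/-- `Trace R w x v` says that `R`, read as a partial function, suffices to compute the value `v`
of the word `w` at `x`. -/
def Trace (R : Set (Cantor × Cantor)) : List (Bool × H) → Cantor → Cantor → Prop
  | [], x, v => v = x
  | (e, h) :: w, x, v => ∃ u z, Trace R w x u ∧ orient e u z ∈ R ∧ v = h.1 z

theorem Trace.mono {R S : Set (Cantor × Cantor)} (hRS : R ⊆ S) {w : List (Bool × H)}
    {x v : Cantor} (h : Trace R w x v) : Trace S w x v := by
  induction w generalizing v with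
  | nil => exact h
  | cons p w ih =>
    obtain ⟨u, z, hu, hz, rfl⟩ := h
    exact ⟨u, z, ih hu, hRS hz, rfl⟩

/-- The value of a word at a point depends continuously on the isometry. -/
theorem Trace.exists_forall_evalWord_mem {R : Set (Cantor × Cantor)} {w : List (Bool × H)}
    {x v : Cantor} (h : Trace R w x v) {O : Set Cantor} (hO : IsOpen O) (hv : v ∈ O) :
    ∃ N, ∀ f, IsIso f → (∀ p ∈ R, Agree N (f p.1) p.2) → evalWord f w x ∈ O := by
  induction w generalizing v O with
  | nil =>
    obtain rfl : v = x := h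
    exact ⟨0, fun f _ _ => hv⟩
  | cons p w ih =>
    obtain ⟨e, k⟩ := p
    obtain ⟨u, z, hu, hz, rfl⟩ := h
    obtain ⟨m, hm⟩ := exists_agree_subset (hO.preimage k.1.continuous) (x := z) hv
    obtain ⟨N, hN⟩ := ih hu (isOpen_setOf_agree u m) (Agree.refl m u)
    refine ⟨max N m, fun f hf hfR => ?_⟩
    have h1 : Agree m u (evalWord f w x) :=
      hN f hf fun p hp => (hfR p hp).mono (le_max_left _ _)
    have h2 := (hfR _ hz).mono (le_max_right N m)
    refine hm (signed f e (evalWord f w x)) ?_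
    -- For an inverse letter, `f` being an isometry turns closeness of `f z` to `u` into closeness
    -- of `z` to the preimage.
    cases e
    · change Agree m (f z) u at h2
      change Agree m z (f.symm (evalWord f w x))
      rw [hf, f.apply_symm_apply]
      exact h2.trans h1
    · exact h2.symm.trans ((hf m _ _).1 h1)

/-- A nontrivial homeomorphism in `H` fixes no cylinder pointwise, so that its fixed points can be
avoided together with a set of size less than the continuum. -/
theorem exists_agree_avoiding {D : Set Cantor} (hD : Dense D)
    (hHD : ∀ h ∈ H, h ≠ 1 → (h '' D) ∩ D = ∅) {S : Set Cantor} (hS : #S < 𝔠) (h : H)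
    (x : Cantor) (n : ℕ) : ∃ z, Agree n x z ∧ z ∉ S ∧ (h ≠ 1 → h.1 z ≠ z) := by
  by_cases h1 : h = 1
  · obtain ⟨z, hz, hzS⟩ := exists_agree_notMem hS x n
    exact ⟨z, hz, hzS, fun hne => absurd h1 hne⟩
  · obtain ⟨d, hd, hxd⟩ := exists_mem_agree hD x n
    have hne : h.1 d ≠ d := fun heq =>
      (Set.ext_iff.1 (hHD h.1 h.2 fun hh => h1 (Subtype.ext hh)) d).1 ⟨⟨d, hd, heq⟩, hd⟩
    obtain ⟨m, hm⟩ := exists_agree_subset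
      (isOpen_ne_fun h.1.continuous continuous_id : IsOpen {y | h.1 y ≠ id y}) hne
    obtain ⟨z, hz, hzS⟩ := exists_agree_notMem hS d (max m n)
    exact ⟨z, hxd.trans (hz.mono (le_max_right _ _)), hzS,
      fun _ => hm z (hz.mono (le_max_left _ _))⟩

/-! ### Density of the avoidance requirements. -/

section Forcing

variable {X Y D A B : Set Cantor}

/-- Every reduced word can be computed at a point by a finite partial isometry below a given condition, in
such a way that the computation either stays in `X` or leaves `X ∪ Y` for good. -/
theorem exists_trace (hX : #X < 𝔠) (hY : #Y < 𝔠)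
    (hHX : ∀ h ∈ H, ∀ x ∈ X, h x ∈ X) (hHY : ∀ h ∈ H, ∀ y ∈ Y, h y ∈ Y)
    (hD : Dense D) (hHD : ∀ h ∈ H, h ≠ 1 → (h '' D) ∩ D = ∅)
    (hAd : Dense A) (hBd : Dense B) (hAX : A ⊆ X) (hBX : B ⊆ X)
    {S : Set (Cantor × Cantor)} (hS : IsCond A B S) {x : Cantor}
    {w : List (Bool × H)} (hw : IsReduced w) :
    ∃ T v, S ⊆ T ∧ T.Finite ∧ PartialIso T ∧ Trace T w x v ∧
      ((T ⊆ A ×ˢ B ∧ v ∈ X) ∨ (v ∉ X ∧ (w ≠ [] → v ∉ Y) ∧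
        ∀ e, (∀ p ∈ w.head?, p.2 = 1 → e = p.1) → ∀ z, orient e v z ∉ T)) := by
  induction w with
  | nil =>
    refine ⟨S, x, subset_rfl, hS.1.1, hS.2, rfl, ?_⟩
    by_cases hxX : x ∈ X
    · exact Or.inl ⟨hS.1.2, hxX⟩
    · refine Or.inr ⟨hxX, fun h => absurd rfl h, fun e _ z hz => hxX ?_⟩
      cases e
      · exact hBX (hS.1.2 hz).2
      · exact hAX (hS.1.2 hz).1
  | cons p w ih =>
    obtain ⟨e, h⟩ := p
    obtain ⟨hhead, hw⟩ := List.isChain_cons.1 hw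
    obtain ⟨T, u, hST, hfin, hT, htr, hor⟩ := ih hw
    by_cases hdef : ∃ z, orient e u z ∈ T
    · obtain ⟨z, hz⟩ := hdef
      rcases hor with ⟨hTAB, -⟩ | ⟨-, -, hno⟩
      · refine ⟨T, h.1 z, hST, hfin, hT, ⟨u, z, htr, hz, rfl⟩, Or.inl ⟨hTAB, hHX _ h.2 _ ?_⟩⟩
        cases e
        · exact hAX (hTAB hz).1
        · exact hBX (hTAB hz).2
      · exact absurd hz (hno e hhead z)
    push Not at hdef
    obtain ⟨z₀, m, hz₀⟩ := hT.exists_agree_insert_orient hfin hdef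
    -- If the new pair can be kept in `A × B`, its value stays in `X`; otherwise a fresh value
    -- outside `X ∪ Y` is chosen.
    by_cases hstay : T ⊆ A ×ˢ B ∧ u ∈ (if e then A else B)
    · obtain ⟨hTAB, hu⟩ := hstay
      obtain ⟨z, hz, hzX, hzAB⟩ : ∃ z, Agree m z₀ z ∧ z ∈ X ∧ orient e u z ∈ A ×ˢ B := by
        cases e
        · obtain ⟨a, ha, h'⟩ := exists_mem_agree hAd z₀ m
          exact ⟨a, h', hAX ha, ha, hu⟩
        · obtain ⟨b, hb, h'⟩ := exists_mem_agree hBd z₀ m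
          exact ⟨b, h', hBX hb, hu, hb⟩
      exact ⟨_, h.1 z, hST.trans (Set.subset_insert _ _), hfin.insert _, hz₀ z hz,
        ⟨u, z, htr.mono (Set.subset_insert _ _), Or.inl rfl, rfl⟩,
        Or.inl ⟨Set.insert_subset hzAB hTAB, hHX _ h.2 _ hzX⟩⟩
    -- Keeping `h z` out of `F` makes it new to `T` and distinct from `u`. The next letter could
    -- then be defined at `h z` only by reversing the pair just added, which needs `h z = z`; the
    -- choice of `z` excludes this for `h ≠ 1`, reducedness for `h = 1`.
    · let F : Set Cantor := insert u (Prod.fst '' T ∪ Prod.snd '' T)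
      have hF : F.Finite := ((hfin.image _).union (hfin.image _)).insert _
      have hcard : #(X ∪ Y ∪ h.1 ⁻¹' F : Set Cantor) < 𝔠 := by
        refine (Cardinal.mk_union_le _ _).trans_lt (Cardinal.add_lt_of_lt
          Cardinal.aleph0_le_continuum ((Cardinal.mk_union_le _ _).trans_lt
          (Cardinal.add_lt_of_lt Cardinal.aleph0_le_continuum hX hY)) ?_)
        exact (hF.preimage h.1.injective.injOn).lt_aleph0.trans Cardinal.aleph0_lt_continuum
      obtain ⟨z, hz, hzS, hzh⟩ := exists_agree_avoiding hD hHD hcard h z₀ m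
      simp only [Set.mem_union, Set.mem_preimage, not_or] at hzS
      obtain ⟨⟨hzX, hzY⟩, hzF⟩ := hzS
      refine ⟨_, h.1 z, hST.trans (Set.subset_insert _ _), hfin.insert _, hz₀ z hz,
        ⟨u, z, htr.mono (Set.subset_insert _ _), Or.inl rfl, rfl⟩, Or.inr ⟨fun hv => hzX ?_,
        fun _ hv => hzY ?_, fun e' he' y hy => ?_⟩⟩
      · simpa using hHX _ (H.inv_mem h.2) _ hv
      · simpa using hHY _ (H.inv_mem h.2) _ hv
      · have he' : h = 1 → e' = e := by simpa using he'
        rcases hy with hy | hy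
        · by_cases hee : e' = e
          · subst hee
            refine hzF (Or.inl ?_)
            cases e'
            · exact congrArg Prod.snd hy
            · exact congrArg Prod.fst hy
          · refine hzh (fun h1 => hee (he' h1)) ?_
            cases e <;> cases e'
            · exact absurd rfl hee
            · exact congrArg Prod.fst hy
            · exact congrArg Prod.snd hy
            · exact absurd rfl hee
        · refine hzF (Or.inr ?_)
          cases e'
          · exact Or.inr ⟨_, hy, rfl⟩
          · exact Or.inl ⟨_, hy, rfl⟩

/-- The conditions that decide a nontrivial reduced word not to map `x` to `y` are dense. -/
theorem exists_cond_evalWord_ne (hX : #X < 𝔠) (hY : #Y < 𝔠)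
    (hHX : ∀ h ∈ H, ∀ x ∈ X, h x ∈ X) (hHY : ∀ h ∈ H, ∀ y ∈ Y, h y ∈ Y)
    (hXY : Disjoint X Y) (hD : Dense D) (hHD : ∀ h ∈ H, h ≠ 1 → (h '' D) ∩ D = ∅)
    (hAd : Dense A) (hBd : Dense B) (hAX : A ⊆ X) (hBX : B ⊆ X)
    {S : Set (Cantor × Cantor)} (hS : IsCond A B S) {x y : Cantor} (hy : y ∈ Y)
    {w : List (Bool × H)} (hw : IsReduced w) (hne : w ≠ []) :
    ∃ T, IsCond A B T ∧ S ⊆ T ∧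
      ∀ f, IsIso f → (∀ p ∈ T, f p.1 = p.2) → evalWord f w x ≠ y := by
  obtain ⟨R, v, hSR, hfin, hR, htr, hor⟩ :=
    exists_trace hX hY hHX hHY hD hHD hAd hBd hAX hBX hS hw
  have hvy : v ≠ y := by
    rintro rfl
    rcases hor with h | h
    · exact hXY.notMem_of_mem_left h.2 hy
    · exact h.2.1 hne hy
  obtain ⟨N, hN⟩ := htr.exists_forall_evalWord_mem isOpen_ne hvy
  -- `R` may leave `A × B`; its approximation `T` is a condition and still contains `S`.
  obtain ⟨T, hTfin, hTAB, hT, hRT, happ⟩ := hR.exists_approx hAd hBd hfin N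
  refine ⟨T, ⟨⟨hTfin, hTAB⟩, hT⟩, fun p hp => hRT ⟨hSR hp, hS.1.2 hp⟩,
    fun f hf hfT => hN f hf fun p hp => ?_⟩
  obtain ⟨q, hq, h1, h2⟩ := happ p hp
  have := (hf N _ _).1 h1
  rw [hfT q hq] at this
  exact this.trans h2.symm

end Forcing

end Words

/-! ### Saturation under `H` and the final assembly. -/

theorem mk_groupImage_lt {H : Subgroup (Cantor ≃ₜ Cantor)} (hH : #H < 𝔠) {X : Set Cantor}
    (hX : #X < 𝔠) : #(groupImage H X) < 𝔠 := by
  have hsub : groupImage H X ⊆ Set.range fun p : H × X => p.1.1 p.2.1 := by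
    intro y hy
    simp only [groupImage, Set.mem_iUnion] at hy
    obtain ⟨h, hh, x, hx, rfl⟩ := hy
    exact ⟨(⟨h, hh⟩, ⟨x, hx⟩), rfl⟩
  refine (Cardinal.mk_le_mk_of_subset hsub).trans_lt (Cardinal.mk_range_le.trans_lt ?_)
  rw [Cardinal.mk_prod, Cardinal.lift_id, Cardinal.lift_id]
  exact Cardinal.mul_lt_of_lt Cardinal.aleph0_le_continuum hH hX

theorem mem_groupImage {H : Subgroup (Cantor ≃ₜ Cantor)} {X : Set Cantor} {y : Cantor} :
    y ∈ groupImage H X ↔ ∃ h ∈ H, ∃ x ∈ X, h x = y := by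
  simp [groupImage]

theorem apply_mem_groupImage {H : Subgroup (Cantor ≃ₜ Cantor)} {X : Set Cantor} :
    ∀ h ∈ H, ∀ x ∈ groupImage H X, h x ∈ groupImage H X := by
  intro h hh x hx
  obtain ⟨k, hk, x', hx', rfl⟩ := mem_groupImage.1 hx
  exact mem_groupImage.2 ⟨h * k, H.mul_mem hh hk, x', hx', rfl⟩

theorem subset_groupImage {H : Subgroup (Cantor ≃ₜ Cantor)} {X : Set Cantor} :
    X ⊆ groupImage H X := fun x hx => mem_groupImage.2 ⟨1, H.one_mem, x, hx, rfl⟩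

end CantorIsometry

open CantorIsometry in
theorem lemma4p2 (hMA : MASigmaCentered)
    (X Y : Set Cantor) (hX : #X < 𝔠) (hY : #Y < 𝔠)
    (H : Subgroup (Cantor ≃ₜ Cantor)) (hH : #H < 𝔠)
    (hHXY : groupImage H X ∩ Y = ∅)
    (D : Set Cantor) (hDc : D.Countable) (hDd : Dense D) (hDY : D ⊆ Y)
    (hHD : ∀ h ∈ H, h ≠ 1 → (h '' D) ∩ D = ∅)
    (A B : Set Cantor) (hAc : A.Countable) (hAd : Dense A) (hBc : B.Countable) (hBd : Dense B)
    (hABX : A ∪ B ⊆ X) :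
    ∃ f : Cantor ≃ₜ Cantor,
      f '' A = B ∧
      groupImage (Subgroup.closure ((H : Set (Cantor ≃ₜ Cantor)) ∪ {f})) X ∩ Y = ∅ ∧
      ∀ h ∈ Subgroup.closure ((H : Set (Cantor ≃ₜ Cantor)) ∪ {f}), h ≠ 1 →
        (h '' D) ∩ D = ∅ := by
  have hdisj : Disjoint (groupImage H X) (groupImage H Y) := by
    rw [Set.disjoint_left]
    rintro _ hx hy
    obtain ⟨h, hh, y, hyY, rfl⟩ := mem_groupImage.1 hy
    have := apply_mem_groupImage _ (H.inv_mem hh) _ hx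
    rw [show h⁻¹ (h y) = y from h.symm_apply_apply y] at this
    exact (Set.ext_iff.1 hHXY y).1 ⟨this, hyY⟩
  have hX' := mk_groupImage_lt hH hX
  have hY' := mk_groupImage_lt hH hY
  have hAX := (Set.subset_union_left.trans hABX).trans (subset_groupImage (H := H))
  have hBX := (Set.subset_union_right.trans hABX).trans (subset_groupImage (H := H))
  -- Starting points are saturated under `H` to absorb the trailing `h`: those in `H[X]` serve the
  -- second conclusion, those in `H[Y]` the third, as `D ⊆ Y`.
  let ι : Type := {w : List (Bool × H) // IsReduced w ∧ w ≠ []} ×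
    ((groupImage H X ∪ groupImage H Y : Set Cantor) × Y)
  have hι : #ι < 𝔠 := by
    have hw : #(List (Bool × H)) < 𝔠 := by
      refine (Cardinal.mk_list_le_max _).trans_lt (max_lt Cardinal.aleph0_lt_continuum ?_)
      rw [Cardinal.mk_prod, Cardinal.lift_id, Cardinal.lift_id]
      exact Cardinal.mul_lt_of_lt Cardinal.aleph0_le_continuum
        ((Cardinal.lt_aleph0_of_finite _).trans Cardinal.aleph0_lt_continuum) hH
    simp only [ι, Cardinal.mk_prod, Cardinal.lift_id]
    refine Cardinal.mul_lt_of_lt Cardinal.aleph0_le_continuum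
      ((Cardinal.mk_subtype_le _).trans_lt hw)
      (Cardinal.mul_lt_of_lt Cardinal.aleph0_le_continuum ?_ hY)
    exact (Cardinal.mk_union_le _ _).trans_lt
      (Cardinal.add_lt_of_lt Cardinal.aleph0_le_continuum hX' hY')
  obtain ⟨f, -, hfAB, hf⟩ := exists_generic_isometry hMA hAc hAd hBc hBd hι
    (fun i f => evalWord f i.1.1 i.2.1.1 ≠ i.2.2.1) fun i S hS =>
      exists_cond_evalWord_ne hX' hY' apply_mem_groupImage apply_mem_groupImage hdisj hDd hHD
        hAd hBd hAX hBX hS (subset_groupImage i.2.2.2) i.1.2.1 i.1.2.2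
  refine ⟨f, hfAB, ?_, fun g hg hg1 => ?_⟩
  · rw [Set.eq_empty_iff_forall_notMem]
    rintro _ ⟨hx, hy⟩
    obtain ⟨g, hg, x, hxX, rfl⟩ := mem_groupImage.1 hx
    obtain ⟨w, h, hw, rfl⟩ := exists_reduced_of_mem_closure hg
    have hhx : h.1 x ∈ groupImage H X := mem_groupImage.2 ⟨h, h.2, x, hxX, rfl⟩
    by_cases hne : w = []
    · subst hne
      exact (Set.ext_iff.1 hHXY _).1 ⟨hhx, hy⟩
    · exact hf (⟨w, hw, hne⟩, ⟨h.1 x, Or.inl hhx⟩, ⟨_, hy⟩) rfl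
  · obtain ⟨w, h, hw, rfl⟩ := exists_reduced_of_mem_closure hg
    by_cases hne : w = []
    · subst hne
      simp only [evalWord, one_mul] at hg1 ⊢
      exact hHD _ h.2 hg1
    · rw [Set.eq_empty_iff_forall_notMem]
      rintro _ ⟨⟨d, hd, rfl⟩, hd'⟩
      exact hf (⟨w, hw, hne⟩, ⟨h.1 d, Or.inr (mem_groupImage.2 ⟨h, h.2, d, hDY hd, rfl⟩)⟩,
        ⟨_, hDY hd'⟩) rfl
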